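/- Let $\mathbb N=\{1,2,3,\dots\}$. For $L\in\mathbb N$ and $l_0,l_1,\dots,l_L\in\mathbb N$, an artificial neural network (ANN) with layer dimensions $(l_0,l_1,\dots,l_L)$ is a tuple $\Phi=((W_1,B_1),\dots,(W_L,B_L))\in\prod_{k=1}^L(\mathbb R^{l_k\times l_{k-1}}\times\mathbb R^{l_k})$. Let $\mathbf N$ be the set of all ANNs (over all $L$ and all $l_0,\dots,l_L$). For such $\Phi$ write $\mathcal I(\Phi)=l_0$, $\mathcal O(\Phi)=l_L$, $\mathcal H(\Phi)=L-1$ (number of hidden layers), $\mathcal P(\Phi)=\sum_{k=1}^L l_k(l_{k-1}+1)$ (number of parameters), let $\|\mathcal T(\Phi)\|_\infty$ be the maximum of the absolute values of all entries of $W_1,B_1,\dots,W_L,B_L$, and let $\mathcal R(\Phi)\colon\mathbb R^{l_0}\to\mathbb R^{l_L}$ be the ReLU realization of $\Phi$, that is, $(\mathcal R(\Phi))(v_0)=W_Lv_{L-1}+B_L$ where $v_k=\mathfrak R(W_kv_{k-1}+B_k)$ for $1\le k\le L-1$ and $\mathfrak R$ is the componentwise map $t\mapsto\max\{t,0\}$.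 For $d\in\mathbb N$, $x\in\mathbb R^d$ let $\varphi_d(x)=(2\pi)^{-d/2}\exp(-\tfrac12\|x\|_2^2)$. Then there exist continuously differentiable functions $\mathfrak f_d\colon\mathbb R^d\to\mathbb R$, $d\in\mathbb N$, such that for all $\delta\in(0,1]$ and $\varepsilon\in(0,\tfrac12]$ there exists $\mathfrak C\in(0,\infty)$ such that (i) for all $\mathfrak c\in[\mathfrak C,\infty)$ and $d\in\mathbb N$, $$\min\left\{p\in\mathbb N\colon\ \begin{gathered}\exists\,\Phi\in\mathbf N\colon\ p=\mathcal P(\Phi),\ \mathcal I(\Phi)=d,\ \mathcal O(\Phi)=1,\\ d\le\mathcal H(\Phi)\le\mathfrak c d,\ \|\mathcal T(\Phi)\|_\infty\le\mathfrak c d^{\mathfrak c},\\ \Big[\int_{\mathbb R^d}|(\mathcal R(\Phi))(x)-\mathfrak f_d(x)|^2\varphi_d(x)\,dx\Big]^{1/2}\le\varepsilon\end{gathered}\right\}\le\mathfrak c d^3,$$ and (ii) for all $\mathfrak c\in[\mathfrak C,\infty)$ and $d\in\mathbb N$, $$\min\left\{p\in\mathbb N\colon\ \begin{gathered}\exists\,\Phi\in\mathbf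 N\colon\ p=\mathcal P(\Phi),\ \mathcal I(\Phi)=d,\ \mathcal O(\Phi)=1,\\ \mathcal H(\Phi)\le\mathfrak c d^{1-\delta},\ \|\mathcal T(\Phi)\|_\infty\le\mathfrak c d^{\mathfrak c},\\ \Big[\int_{\mathbb R^d}|(\mathcal R(\Phi))(x)-\mathfrak f_d(x)|^2\varphi_d(x)\,dx\Big]^{1/2}\le\varepsilon\end{gathered}\right\}\ge(1+\mathfrak c^{-3})^{(d^\delta)}.$$ In both items the set is non-empty, so that the minimum exists. -/

import Mathlib

open MeasureTheory

/-- Feedforward artificial neural networks with input dimension `m` and output dimension `n`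
(first and second index): finite nonempty sequences `((W₁, B₁), …, (W_L, B_L))` of real weight
matrices and bias vectors, `W_k` of size `l_k × l_{k-1}` and `B_k` of size `l_k`, with `l_0 = m`,
`l_L = n` and all dimensions `l_0, …, l_L` positive. `output` is the case `L = 1`, and `hidden`
puts one more pair `(W, B)` in front of a given sequence. -/
inductive ANN : ℕ → ℕ → Type
  | output {m n : ℕ} (hm : 0 < m) (hn : 0 < n)
      (W : Matrix (Fin n) (Fin m) ℝ) (B : Fin n → ℝ) : ANN m n
  | hidden {m k n : ℕ} (hm : 0 < m) (hk : 0 < k)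
      (W : Matrix (Fin k) (Fin m) ℝ) (B : Fin k → ℝ) (Φ : ANN k n) : ANN m n

/-- The multidimensional rectifier `(x₁, …, x_k) ↦ (max {x₁, 0}, …, max {x_k, 0})`. -/
noncomputable def rectifier {k : ℕ} (x : Fin k → ℝ) : Fin k → ℝ :=
  fun i => max (x i) 0

namespace ANN

open scoped Matrix

/-- The realization function: the rectifier is applied after every affine map but the last. -/
noncomputable def realization : {m n : ℕ} → ANN m n → (Fin m → ℝ) → (Fin n → ℝ)
  | _, _, output _ _ W B, x => W *ᵥ x + B
  | _, _, hidden _ _ W B Φ, x => Φ.realization (rectifier (W *ᵥ x + B))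

/-- The number of hidden layers `L - 1`. -/
def numHidden : {m n : ℕ} → ANN m n → ℕ
  | _, _, output _ _ _ _ => 0
  | _, _, hidden _ _ _ _ Φ => Φ.numHidden + 1

/-- The number of parameters `∑ k ∈ {1, …, L}, l_k * (l_{k-1} + 1)`. -/
def numParams : {m n : ℕ} → ANN m n → ℕ
  | m, n, output _ _ _ _ => n * (m + 1)
  | m, _, hidden (k := k) _ _ _ _ Φ => k * (m + 1) + Φ.numParams

/-- The maximum of the absolute values of all weights and biases, that is, the maximum norm of
the vector of all parameters. The norm of a real-valued function on a finite type is the maximum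
of the absolute values of its values. -/
noncomputable def paramNorm : {m n : ℕ} → ANN m n → ℝ
  | m, n, output _ _ W B => max ‖fun p : Fin n × Fin m => W p.1 p.2‖ ‖B‖
  | m, _, hidden (k := k) _ _ W B Φ =>
      max (max ‖fun p : Fin k × Fin m => W p.1 p.2‖ ‖B‖) Φ.paramNorm

end ANN

/-- The density `(2 π) ^ (-d / 2) * exp (-(1 / 2) * ∑ j, x_j ^ 2)` of the standard normal
distribution on `ℝ ^ d`. -/
noncomputable def gaussianDensity (d : ℕ) (x : Fin d → ℝ) : ℝ :=
  (2 * Real.pi) ^ (-(d : ℝ) / 2) * Real.exp (-(1 / 2) * ∑ j, x j ^ 2)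

/-- The error `(∫ |u x - v x| ^ 2 * φ_d x dx) ^ (1 / 2) ∈ [0, ∞]` of two real functions on `ℝ ^ d`,
with `φ_d` the standard normal density. -/
noncomputable def gaussianL2Error (d : ℕ) (u v : (Fin d → ℝ) → ℝ) : ENNReal :=
  (∫⁻ x : Fin d → ℝ, ENNReal.ofReal (|u x - v x| ^ 2 * gaussianDensity d x)) ^ (1 / 2 : ℝ)

/-! ### Growth of realizations -/

namespace ANN

open scoped Matrix

/-! Depth buys exponential growth cheaply. The target `steepRampSum` is at least `16 ^ d - 1 / 2` on
`[1, 2] ^ d`. A network with `H` hidden layers, `P` parameters and weights bounded by `M` is at most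
`2 * (M * P) ^ (H + 1)` there (`ANN.abs_realization_le`), and a small Gaussian error forces it to
within `8 ^ d` of the target at some point of the box. Hence `2 ^ d ≤ (M * P) ^ (H + 1)`, and for
`H` of order `d ^ (1 - δ)` and `M` polynomial in `d`, taking logarithms makes `P` exponential in `d
^ δ` (`rpow_le_of_two_pow_le`). Conversely, `d` layers of width `d` multiply by `16` each, and one
further layer evaluates Riemann sums of the ramps (`exists_deep_ann`). A shallow network of
exponential width shows that the second set is non-empty (`exists_shallow_ann`). -/

lemma input_lt_numParams {m n : ℕ} (Φ : ANN m n) : m + 1 ≤ Φ.numParams := by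
  cases Φ with
  | output hm hn W B => exact Nat.le_mul_of_pos_left _ hn
  | hidden hm hk W B Φ => exact (Nat.le_mul_of_pos_left _ hk).trans (Nat.le_add_right _ _)

lemma abs_affine_le {m n : ℕ} (W : Matrix (Fin n) (Fin m) ℝ) (B : Fin n → ℝ) (x : Fin m → ℝ)
    {M R : ℝ} (hW : ∀ i j, |W i j| ≤ M) (hB : ∀ i, |B i| ≤ M) (hR : 1 ≤ R)
    (hx : ∀ j, |x j| ≤ R) (i : Fin n) : |(W *ᵥ x + B) i| ≤ M * (m + 1) * R := by
  have hM : 0 ≤ M := (abs_nonneg _).trans (hB i)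
  have h1 : |∑ j, W i j * x j| ≤ m * (M * R) := by
    refine (Finset.abs_sum_le_sum_abs _ _).trans ?_
    refine (Finset.sum_le_card_nsmul _ _ (M * R) fun j _ => ?_).trans_eq (by simp)
    rw [abs_mul]
    exact mul_le_mul (hW i j) (hx j) (abs_nonneg _) hM
  calc |(W *ᵥ x + B) i| = |∑ j, W i j * x j + B i| := rfl
    _ ≤ m * (M * R) + M := (abs_add_le _ _).trans (add_le_add h1 (hB i))
    _ ≤ M * (m + 1) * R := by nlinarith

lemma abs_weight_le {m n : ℕ} {W : Matrix (Fin n) (Fin m) ℝ} {M : ℝ}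
    (h : ‖fun p : Fin n × Fin m => W p.1 p.2‖ ≤ M) (i : Fin n) (j : Fin m) : |W i j| ≤ M :=
  (norm_le_pi_norm (fun p : Fin n × Fin m => W p.1 p.2) (i, j)).trans h

/-- Each layer enlarges the sup bound by at most `M * (m + 1) ≤ M * P`: `R ≥ 1` absorbs the bias,
and the rectifier does not increase absolute values. -/
theorem abs_realization_le {m n : ℕ} (Φ : ANN m n) {M P R : ℝ} (hM : 1 ≤ M)
    (hΦ : Φ.paramNorm ≤ M) (hP : (Φ.numParams : ℝ) ≤ P) (hR : 1 ≤ R) (x : Fin m → ℝ)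
    (hx : ∀ j, |x j| ≤ R) (i : Fin n) :
    |Φ.realization x i| ≤ (M * P) ^ (Φ.numHidden + 1) * R := by
  induction Φ generalizing R with
  | @output m n hm hn W B =>
    simp only [paramNorm, max_le_iff] at hΦ
    have hmP : (m : ℝ) + 1 ≤ P :=
      le_trans (by exact_mod_cast input_lt_numParams (output hm hn W B)) hP
    refine (abs_affine_le W B x (abs_weight_le hΦ.1)
      (fun i => (norm_le_pi_norm B i).trans hΦ.2) hR hx i).trans ?_
    simp only [numHidden, zero_add, pow_one]
    gcongr
  | @hidden m k n hm hk W B Φ ih =>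
    simp only [paramNorm, max_le_iff] at hΦ
    have hmP : (m : ℝ) + 1 ≤ P :=
      le_trans (by exact_mod_cast input_lt_numParams (hidden hm hk W B Φ)) hP
    have hP1 : 1 ≤ P := le_trans (by linarith [Nat.cast_nonneg (α := ℝ) m]) hmP
    have hMP : 1 ≤ M * P := one_le_mul_of_one_le_of_one_le hM hP1
    have hstep : ∀ j, |rectifier (W *ᵥ x + B) j| ≤ M * P * R := fun j => by
      have h := abs_affine_le W B x (abs_weight_le hΦ.1.1)
        (fun i => (norm_le_pi_norm B i).trans hΦ.1.2) hR hx j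
      have h2 : |rectifier (W *ᵥ x + B) j| ≤ |(W *ᵥ x + B) j| := by
        unfold rectifier
        rw [abs_of_nonneg (le_max_right _ _)]
        exact max_le (le_abs_self _) (abs_nonneg _)
      refine h2.trans (h.trans ?_)
      gcongr
    have hnum : (Φ.numParams : ℝ) ≤ P :=
      le_trans (by exact_mod_cast Nat.le_add_left _ _) hP
    refine (ih hΦ.2 hnum (one_le_mul_of_one_le_of_one_le hMP hR) _ hstep i).trans_eq ?_
    simp only [numHidden]
    ring

end ANN

/-! ### The Gaussian error -/

open ProbabilityTheory in
lemma gaussianDensity_eq_prod (d : ℕ) (x : Fin d → ℝ) :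
    gaussianDensity d x = ∏ i, gaussianPDFReal 0 1 (x i) := by
  simp only [gaussianPDFReal, gaussianDensity, Finset.prod_mul_distrib, Finset.prod_const,
    Finset.card_univ, Fintype.card_fin, ← Real.exp_sum, NNReal.coe_one, mul_one, sub_zero]
  congr 1
  · have h : (0 : ℝ) ≤ 2 * Real.pi := by positivity
    rw [Real.sqrt_eq_rpow, ← Real.rpow_neg h, ← Real.rpow_natCast, ← Real.rpow_mul h]
    congr 1
    ring
  · rw [Finset.mul_sum]
    congr 1
    exact Finset.sum_congr rfl fun i _ => by ring

lemma gaussianDensity_nonneg (d : ℕ) (x : Fin d → ℝ) : 0 ≤ gaussianDensity d x := by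
  unfold gaussianDensity
  positivity

open ProbabilityTheory in
lemma lintegral_gaussianDensity (d : ℕ) :
    ∫⁻ x : Fin d → ℝ, ENNReal.ofReal (gaussianDensity d x) = 1 := by
  simp_rw [gaussianDensity_eq_prod]
  rw [← ofReal_integral_eq_lintegral_ofReal, integral_fintype_prod_volume_eq_prod]
  · simp [integral_gaussianPDFReal_eq_one]
  · exact Integrable.fintype_prod (fun _ => integrable_gaussianPDFReal 0 1)
  · exact Filter.Eventually.of_forall fun x =>
      Finset.prod_nonneg fun i _ => gaussianPDFReal_nonneg _ _ _

lemma gaussianL2Error_le_of_abs_sub_le {d : ℕ} {u v : (Fin d → ℝ) → ℝ} {ε : ℝ} (hε : 0 ≤ ε)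
    (h : ∀ x, |u x - v x| ≤ ε) : gaussianL2Error d u v ≤ ENNReal.ofReal ε := by
  have h1 : (∫⁻ x : Fin d → ℝ, ENNReal.ofReal (|u x - v x| ^ 2 * gaussianDensity d x))
      ≤ ENNReal.ofReal (ε ^ 2) := by
    calc _ ≤ ∫⁻ x : Fin d → ℝ, ENNReal.ofReal (ε ^ 2) * ENNReal.ofReal (gaussianDensity d x) := by
          refine lintegral_mono fun x => ?_
          rw [← ENNReal.ofReal_mul (by positivity)]
          refine ENNReal.ofReal_le_ofReal ?_
          have := h x
          have := gaussianDensity_nonneg d x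
          gcongr
      _ = ENNReal.ofReal (ε ^ 2) := by
          rw [lintegral_const_mul' _ _ ENNReal.ofReal_ne_top, lintegral_gaussianDensity, mul_one]
  refine (ENNReal.rpow_le_rpow h1 (by norm_num)).trans_eq ?_
  rw [ENNReal.ofReal_rpow_of_nonneg (by positivity) (by norm_num), ← Real.sqrt_eq_rpow,
    Real.sqrt_sq hε]

open ProbabilityTheory in
lemma le_gaussianDensity {d : ℕ} {x : Fin d → ℝ} (hx : ∀ i, |x i| ≤ 2) :
    (1 / 64 : ℝ) ^ d ≤ gaussianDensity d x := by
  rw [gaussianDensity_eq_prod]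
  have h1 : ∀ i, (1 / 64 : ℝ) ≤ gaussianPDFReal 0 1 (x i) := fun i => by
    simp only [gaussianPDFReal, NNReal.coe_one, mul_one, sub_zero]
    have h2 : (1 / 4 : ℝ) ≤ (√(2 * Real.pi))⁻¹ := by
      rw [one_div]
      refine inv_anti₀ (by positivity) ?_
      rw [Real.sqrt_le_left (by norm_num)]
      linarith [Real.pi_le_four]
    have h3 : (1 / 16 : ℝ) ≤ Real.exp (-x i ^ 2 / 2) := by
      have h4 : Real.exp 1 ≤ 4 := by linarith [Real.exp_one_lt_d9]
      have h5 : Real.exp 2 ≤ 16 := by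
        have : Real.exp 2 = Real.exp 1 ^ 2 := by rw [← Real.exp_nat_mul]; norm_num
        rw [this]
        nlinarith [Real.exp_pos 1]
      have h6 : x i ^ 2 ≤ 4 := by
        have := abs_le.1 (hx i)
        nlinarith
      calc (1 / 16 : ℝ) ≤ (Real.exp 2)⁻¹ := by
            rw [one_div]
            exact inv_anti₀ (Real.exp_pos _) h5
        _ = Real.exp (-2) := (Real.exp_neg _).symm
        _ ≤ _ := Real.exp_le_exp.2 (by linarith)
    calc (1 / 64 : ℝ) = 1 / 4 * (1 / 16) := by norm_num
      _ ≤ _ := mul_le_mul h2 h3 (by norm_num) (by positivity)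
  calc (1 / 64 : ℝ) ^ d = ∏ _i : Fin d, (1 / 64 : ℝ) := by simp
    _ ≤ _ := Finset.prod_le_prod (fun _ _ => by norm_num) fun i _ => h1 i

/-- The box `[1, 2] ^ d` has volume `1`, so a small error forces closeness at one of its points. -/
lemma exists_abs_sub_lt_of_gaussianL2Error_lt_one {d : ℕ} {u v : (Fin d → ℝ) → ℝ}
    (h : gaussianL2Error d u v < 1) :
    ∃ x : Fin d → ℝ, (∀ i, 1 ≤ x i ∧ x i ≤ 2) ∧ |u x - v x| < 8 ^ d := by
  by_contra! hcon
  have hbox : volume (Set.Icc (fun _ : Fin d => (1 : ℝ)) (fun _ => 2)) = 1 := by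
    rw [Real.volume_Icc_pi]
    norm_num
  have h1 : 1 ≤ ∫⁻ x : Fin d → ℝ, ENNReal.ofReal (|u x - v x| ^ 2 * gaussianDensity d x) := by
    calc (1 : ENNReal) = ∫⁻ _ in Set.Icc (fun _ : Fin d => (1 : ℝ)) (fun _ => 2), 1 := by
          rw [setLIntegral_const, hbox, one_mul]
      _ ≤ ∫⁻ x in Set.Icc (fun _ : Fin d => (1 : ℝ)) (fun _ => 2),
            ENNReal.ofReal (|u x - v x| ^ 2 * gaussianDensity d x) := by
          refine setLIntegral_mono' measurableSet_Icc fun x hx => ?_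
          rw [ENNReal.one_le_ofReal]
          have hx' : ∀ i, 1 ≤ x i ∧ x i ≤ 2 := fun i => ⟨hx.1 i, hx.2 i⟩
          -- The threshold `8 ^ d` is the one whose square cancels the lower bound `64 ^ (-d)` of
          -- the density.
          calc (1 : ℝ) = (8 ^ d) ^ 2 * (1 / 64) ^ d := by
                rw [← pow_mul, mul_comm d, pow_mul, ← mul_pow]
                norm_num
            _ ≤ _ := by
                have := hcon x hx'
                have := le_gaussianDensity (x := x) fun i => by
                  rw [abs_of_nonneg (by linarith [(hx' i).1])]
                  exact (hx' i).2
                gcongr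
      _ ≤ _ := setLIntegral_le_lintegral _ _
  exact absurd (ENNReal.one_le_rpow h1 (by norm_num : (0 : ℝ) < 1 / 2)) (not_le.2 h)

/-! ### The target functions -/

/-- The `C¹` ramp `t ↦ ∫₀¹ max (t - s) 0 ds`: zero for `t ≤ 0`, equal to `t² / 2` on `[0, 1]` and
to `t - 1 / 2` for `t ≥ 1`. -/
noncomputable def smoothRamp (t : ℝ) : ℝ := (max t 0 ^ 2 - max (t - 1) 0 ^ 2) / 2

lemma contDiff_max_zero_sq : ContDiff ℝ 1 fun t : ℝ => max t 0 ^ 2 := by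
  have hd : ∀ t : ℝ, HasDerivAt (fun t : ℝ => max t 0 ^ 2) (2 * max t 0) t := fun t => by
    rcases lt_trichotomy t 0 with ht | rfl | ht
    · rw [max_eq_right ht.le, mul_zero]
      refine (hasDerivAt_const t (0 : ℝ)).congr_of_eventuallyEq ?_
      filter_upwards [Iio_mem_nhds ht] with s hs
      rw [max_eq_right (le_of_lt hs)]
      norm_num
    · rw [hasDerivAt_iff_isLittleO]
      have : (fun x : ℝ => max x 0 ^ 2) =O[nhds 0] fun x : ℝ => x ^ 2 := by
        refine Asymptotics.IsBigO.of_bound 1 (Filter.Eventually.of_forall fun x => ?_)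
        rw [Real.norm_of_nonneg (by positivity), Real.norm_of_nonneg (by positivity), one_mul,
          sq_le_sq, abs_of_nonneg (le_max_right x 0)]
        exact max_le (le_abs_self _) (abs_nonneg _)
      simpa using this.trans_isLittleO (Asymptotics.isLittleO_pow_id one_lt_two)
    · rw [max_eq_left ht.le]
      refine HasDerivAt.congr_of_eventuallyEq (f := fun s : ℝ => s ^ 2) ?_ ?_
      · simpa using hasDerivAt_pow 2 t
      · filter_upwards [Ioi_mem_nhds ht] with s hs
        rw [max_eq_left (le_of_lt hs)]
  rw [contDiff_one_iff_deriv]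
  refine ⟨fun t => (hd t).differentiableAt, ?_⟩
  rw [show deriv (fun t : ℝ => max t 0 ^ 2) = fun t => 2 * max t 0 from funext fun t => (hd t).deriv]
  fun_prop

lemma contDiff_smoothRamp : ContDiff ℝ 1 smoothRamp :=
  (contDiff_max_zero_sq.sub
    (contDiff_max_zero_sq.comp (contDiff_id.sub contDiff_const))).div_const 2

/-- This is why rectifying the inputs in the amplifying layers loses nothing. -/
lemma smoothRamp_max_zero (t : ℝ) : smoothRamp (max t 0) = smoothRamp t := by
  rcases le_total t 0 with h | h
  · unfold smoothRamp
    rw [max_eq_right h, max_eq_right (by linarith : t - 1 ≤ 0)]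
    norm_num
  · rw [max_eq_left h]

lemma smoothRamp_nonneg (t : ℝ) : 0 ≤ smoothRamp t := by
  have h : max (t - 1) 0 ≤ max t 0 := max_le_max (by linarith) le_rfl
  have := pow_le_pow_left₀ (le_max_right (t - 1) 0) h 2
  unfold smoothRamp
  linarith

lemma smoothRamp_of_one_le {t : ℝ} (ht : 1 ≤ t) : smoothRamp t = t - 1 / 2 := by
  unfold smoothRamp
  rw [max_eq_left (by linarith), max_eq_left (by linarith)]
  ring

lemma abs_smoothRamp_sub_riemannSum_le (N : ℕ) (hN : 0 < N) (t : ℝ) :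
    |∑ k ∈ Finset.range N, (1 / N : ℝ) * max (t - k / N) 0 - smoothRamp t| ≤ 1 / N := by
  have hN' : (0 : ℝ) < N := by exact_mod_cast hN
  -- The half difference of squares is the integral of `max (u - s) 0` over `[0, h]`; the integrand
  -- is 1-Lipschitz. The `N` cells of length `1 / N` telescope to the ramp.
  have cell : ∀ u h : ℝ, 0 ≤ h →
      |h * max u 0 - (max u 0 ^ 2 - max (u - h) 0 ^ 2) / 2| ≤ h ^ 2 := fun u h hh => by
    rw [abs_le]
    rcases le_total u 0 with h1 | h1
    · rw [max_eq_right h1, max_eq_right (by linarith)]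
      constructor <;> nlinarith
    · rw [max_eq_left h1]
      rcases le_total u h with h2 | h2
      · rw [max_eq_right (by linarith)]
        constructor <;> nlinarith
      · rw [max_eq_left (by linarith)]
        constructor <;> nlinarith
  have htel : smoothRamp t = ∑ k ∈ Finset.range N,
      (max (t - k / N) 0 ^ 2 - max (t - k / N - 1 / N) 0 ^ 2) / 2 := by
    have := Finset.sum_range_sub' (fun k : ℕ => max (t - k / N) 0 ^ 2 / 2) N
    rw [div_self hN'.ne'] at this
    unfold smoothRamp
    rw [sub_div]
    simp only [Nat.cast_zero, zero_div, sub_zero] at this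
    rw [← this]
    refine Finset.sum_congr rfl fun k _ => ?_
    rw [sub_div, Nat.cast_add_one, add_div, sub_sub]
  rw [htel, ← Finset.sum_sub_distrib]
  refine (Finset.abs_sum_le_sum_abs _ _).trans ?_
  refine (Finset.sum_le_card_nsmul (Finset.range N) _ ((1 / N : ℝ) ^ 2) fun k _ =>
    cell (t - k / N) (1 / N) (by positivity)).trans_eq ?_
  rw [Finset.card_range, nsmul_eq_mul]
  field_simp

/-- The target function: a sum of ramps, steepened by a factor exponential in the dimension. -/
noncomputable def steepRampSum (d : ℕ) (x : Fin d → ℝ) : ℝ := ∑ i, smoothRamp (16 ^ d * x i)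

lemma contDiff_steepRampSum (d : ℕ) : ContDiff ℝ 1 (steepRampSum d) :=
  ContDiff.sum fun i _ => contDiff_smoothRamp.comp (contDiff_const.mul (contDiff_apply ℝ ℝ i))

lemma le_steepRampSum {d : ℕ} (hd : 1 ≤ d) {x : Fin d → ℝ} (hx : ∀ i, 1 ≤ x i) :
    (16 : ℝ) ^ d - 1 / 2 ≤ steepRampSum d x := by
  have h16 : (1 : ℝ) ≤ 16 ^ d := one_le_pow₀ (by norm_num)
  have h1 : (16 : ℝ) ^ d ≤ 16 ^ d * x ⟨0, hd⟩ := le_mul_of_one_le_right (by positivity) (hx _)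
  have h2 := Finset.single_le_sum (f := fun i => smoothRamp (16 ^ d * x i))
    (fun i _ => smoothRamp_nonneg _) (Finset.mem_univ (⟨0, hd⟩ : Fin d))
  refine le_trans ?_ h2
  rw [smoothRamp_of_one_le (h16.trans h1)]
  linarith

/-! ### Approximating networks -/

namespace ANN

open scoped Matrix

/-- The network with one hidden layer computing
`x ↦ ∑ i < d, ∑ k < N, a * max (x i - k * b) 0`. -/
noncomputable def rampSum {d N : ℕ} (hd : 0 < d) (hN : 0 < N) (a b : ℝ) : ANN d 1 :=
  hidden hd (Nat.mul_pos hd hN)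
    (fun p j => if (finProdFinEquiv.symm p).1 = j then 1 else 0)
    (fun p => -((finProdFinEquiv.symm p).2 * b))
    (output (Nat.mul_pos hd hN) one_pos (fun _ _ => a) 0)

lemma realization_rampSum {d N : ℕ} (hd : 0 < d) (hN : 0 < N) (a b : ℝ) (x : Fin d → ℝ) :
    (rampSum hd hN a b).realization x 0
      = ∑ i, ∑ k ∈ Finset.range N, a * max (x i - k * b) 0 := by
  simp only [rampSum, realization, Matrix.mulVec, dotProduct, Pi.add_apply, Pi.zero_apply,
    add_zero, rectifier]
  rw [← finProdFinEquiv.sum_comp, Fintype.sum_prod_type]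
  refine Finset.sum_congr rfl fun i _ => ?_
  rw [Finset.sum_range]
  refine Finset.sum_congr rfl fun k _ => ?_
  simp [sub_eq_add_neg]

lemma numHidden_rampSum {d N : ℕ} (hd : 0 < d) (hN : 0 < N) (a b : ℝ) :
    (rampSum hd hN a b).numHidden = 1 := rfl

lemma numParams_rampSum {d N : ℕ} (hd : 0 < d) (hN : 0 < N) (a b : ℝ) :
    (rampSum hd hN a b).numParams = d * N * (d + 1) + (d * N + 1) := by
  simp [rampSum, numParams]

lemma paramNorm_rampSum_le {d N : ℕ} (hd : 0 < d) (hN : 0 < N) {a b : ℝ} (ha : |a| ≤ 1)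
    (hb : 0 ≤ b) (hNb : N * b ≤ 1) : (rampSum hd hN a b).paramNorm ≤ 1 := by
  simp only [rampSum, paramNorm, max_le_iff, pi_norm_le_iff_of_nonneg zero_le_one]
  refine ⟨⟨fun p => ?_, fun p => ?_⟩, fun _ => ha, by simp⟩
  · split_ifs <;> simp
  · rw [norm_neg, Real.norm_of_nonneg (by positivity)]
    refine le_trans ?_ hNb
    gcongr
    exact (finProdFinEquiv.symm p).2.2.le

/-- Put `n` hidden layers `x ↦ max (16 * x) 0` in front of a network. -/
noncomputable def amplify {d m : ℕ} (hd : 0 < d) (Φ : ANN d m) : ℕ → ANN d m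
  | 0 => Φ
  | n + 1 => hidden hd hd ((16 : ℝ) • (1 : Matrix (Fin d) (Fin d) ℝ)) 0 (amplify hd Φ n)

/-- After the first layer all entries are nonnegative, so later rectifiers act trivially. With no
layer there would be no positive part, hence `n + 1`. -/
lemma realization_amplify {d m : ℕ} (hd : 0 < d) (Φ : ANN d m) (n : ℕ) (x : Fin d → ℝ) :
    (amplify hd Φ (n + 1)).realization x
      = Φ.realization fun i => 16 ^ (n + 1) * max (x i) 0 := by
  have hrect : ∀ x : Fin d → ℝ,
      rectifier (((16 : ℝ) • (1 : Matrix (Fin d) (Fin d) ℝ)) *ᵥ x + 0)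
        = fun i => 16 * max (x i) 0 := fun x => by
    funext i
    simp [rectifier, Matrix.smul_mulVec, mul_max_of_nonneg]
  induction n generalizing x with
  | zero => rw [amplify, amplify, realization, hrect, zero_add, pow_one]
  | succ n ih =>
    rw [amplify, realization, hrect, ih]
    congr 1
    funext i
    rw [max_eq_left (by positivity)]
    ring

lemma numHidden_amplify {d m : ℕ} (hd : 0 < d) (Φ : ANN d m) (n : ℕ) :
    (amplify hd Φ n).numHidden = n + Φ.numHidden := by
  induction n with
  | zero => simp [amplify]
  | succ n ih => rw [amplify, numHidden, ih]; ring

lemma numParams_amplify {d m : ℕ} (hd : 0 < d) (Φ : ANN d m) (n : ℕ) :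
    (amplify hd Φ n).numParams = n * (d * (d + 1)) + Φ.numParams := by
  induction n with
  | zero => simp [amplify]
  | succ n ih => rw [amplify, numParams, ih]; ring

lemma paramNorm_amplify_le {d m : ℕ} (hd : 0 < d) {Φ : ANN d m} (hΦ : Φ.paramNorm ≤ 16) (n : ℕ) :
    (amplify hd Φ n).paramNorm ≤ 16 := by
  induction n with
  | zero => simpa [amplify]
  | succ n ih =>
    have h16 : (0 : ℝ) ≤ 16 := by norm_num
    simp only [amplify, paramNorm, max_le_iff, pi_norm_le_iff_of_nonneg h16]
    refine ⟨⟨fun p => ?_, by simp⟩, ih⟩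
    by_cases h : p.1 = p.2 <;> simp [h]

end ANN

/-- If the scaled inputs agree up to the rectifier, sums of ramps are uniformly approximated. -/
lemma abs_riemannSum_sub_steepRampSum_le {d N : ℕ} (hN : 0 < N) {ε : ℝ} (hdN : d / N ≤ ε)
    (x y : Fin d → ℝ) (hxy : ∀ i, max (y i) 0 = max (16 ^ d * x i) 0) :
    |∑ i, ∑ k ∈ Finset.range N, (1 / N : ℝ) * max (y i - k / N) 0 - steepRampSum d x| ≤ ε := by
  rw [steepRampSum, ← Finset.sum_sub_distrib]
  refine (Finset.abs_sum_le_sum_abs _ _).trans ?_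
  refine (Finset.sum_le_card_nsmul _ _ (1 / N : ℝ) fun i _ => ?_).trans ?_
  · rw [← smoothRamp_max_zero, ← hxy, smoothRamp_max_zero]
    exact abs_smoothRamp_sub_riemannSum_le N hN (y i)
  · simpa [div_eq_mul_inv] using hdN

/-- A deep network with `d + 1` hidden layers approximating the target function. -/
theorem exists_deep_ann {d : ℕ} (hd : 1 ≤ d) {ε : ℝ} (hε : 0 < ε) (hε1 : ε ≤ 1 / 2) :
    ∃ Φ : ANN d 1, Φ.numHidden = d + 1 ∧ Φ.paramNorm ≤ 16 ∧
      (Φ.numParams : ℝ) ≤ 16 / ε * (d : ℝ) ^ 3 ∧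
      gaussianL2Error d (fun x => Φ.realization x 0) (steepRampSum d) ≤ ENNReal.ofReal ε := by
  have hd' : (1 : ℝ) ≤ d := by exact_mod_cast hd
  have hdε : 0 < (d : ℝ) / ε := by positivity
  -- Each of the `d` ramps costs an error `1 / N`, so this makes the total at most `ε`, while `N`
  -- linear in `d` keeps the parameter count cubic.
  set N := ⌈(d : ℝ) / ε⌉₊ with hNdef
  have hN : 0 < N := Nat.ceil_pos.2 hdε
  have hN' : (0 : ℝ) < N := by exact_mod_cast hN
  have hN1 : (d : ℝ) / ε ≤ N := Nat.le_ceil _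
  have hN2 : (N : ℝ) ≤ 2 * (d / ε) := by
    have h1 : (N : ℝ) < d / ε + 1 := Nat.ceil_lt_add_one hdε.le
    have h2 : 1 ≤ (d : ℝ) / ε := by
      rw [one_le_div hε]
      linarith
    linarith
  have hdN : (d : ℝ) / N ≤ ε := by
    rw [div_le_iff₀ hN']
    rwa [div_le_iff₀' hε] at hN1
  refine ⟨ANN.amplify hd (ANN.rampSum hd hN (1 / N) (1 / N)) d, ?_, ?_, ?_, ?_⟩
  · rw [ANN.numHidden_amplify, ANN.numHidden_rampSum]
  · refine ANN.paramNorm_amplify_le hd ((ANN.paramNorm_rampSum_le hd hN ?_ ?_ ?_).trans ?_) d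
    · rw [abs_of_nonneg (by positivity), div_le_one hN']
      exact_mod_cast hN
    · positivity
    · rw [mul_one_div_cancel hN'.ne']
    · norm_num
  · rw [ANN.numParams_amplify, ANN.numParams_rampSum]
    push_cast
    have hN3 : (1 : ℝ) ≤ N := by exact_mod_cast hN
    have hε2 : 2 ≤ 1 / ε := by
      rw [le_div_iff₀ hε]
      linarith
    have h1 : (d : ℝ) * N ≤ 2 * (1 / ε) * d ^ 2 := by
      calc (d : ℝ) * N ≤ d * (2 * (d / ε)) := by gcongr
        _ = _ := by ring
    have h2 : (d : ℝ) ^ 2 ≤ d ^ 3 := pow_le_pow_right₀ hd' (by norm_num)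
    have h3 : (d : ℝ) * N * (d + 1) ≤ 2 * (1 / ε) * d ^ 2 * (2 * d) := by
      gcongr
      linarith
    have h4 : (1 : ℝ) ≤ d ^ 3 := one_le_pow₀ hd'
    have h5 : 2 * (1 / ε) * (d : ℝ) ^ 2 ≤ 2 * (1 / ε) * d ^ 3 := by gcongr
    have h6 : 2 * (d : ℝ) ^ 3 ≤ 1 / ε * d ^ 3 := by gcongr
    calc (d : ℝ) * (d * (d + 1)) + (d * N * (d + 1) + (d * N + 1))
        = d ^ 3 + d ^ 2 + d * N * (d + 1) + d * N + 1 := by ring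
      _ ≤ 16 * (1 / ε * d ^ 3) := by nlinarith
      _ = _ := by ring
  · refine gaussianL2Error_le_of_abs_sub_le hε.le fun x => ?_
    obtain ⟨n, rfl⟩ : ∃ n, d = n + 1 := ⟨d - 1, by omega⟩
    rw [ANN.realization_amplify, ANN.realization_rampSum]
    simp only [mul_one_div]
    have h16 : (0 : ℝ) ≤ 16 ^ (n + 1) := by positivity
    refine abs_riemannSum_sub_steepRampSum_le hN hdN x _ fun i => ?_
    rw [max_eq_left (by positivity), mul_max_of_nonneg _ _ h16, mul_zero]

/-- A shallow network of exponential width approximating the target function. -/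
theorem exists_shallow_ann {d : ℕ} (hd : 1 ≤ d) {ε : ℝ} (hε : 0 < ε) :
    ∃ Φ : ANN d 1, Φ.numHidden = 1 ∧ Φ.paramNorm ≤ 1 ∧
      gaussianL2Error d (fun x => Φ.realization x 0) (steepRampSum d) ≤ ENNReal.ofReal ε := by
  -- The first bound gives accuracy; the second keeps the outer weight `16 ^ d / N` at most `1`.
  obtain ⟨N, hN0⟩ := exists_nat_ge (max ((d : ℝ) / ε) (16 ^ d))
  obtain ⟨hN1, hN2⟩ := max_le_iff.1 hN0
  have h16 : (1 : ℝ) ≤ 16 ^ d := one_le_pow₀ (by norm_num)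
  have hN' : (0 : ℝ) < N := by linarith
  have hN : 0 < N := by exact_mod_cast hN'
  have hdN : (d : ℝ) / N ≤ ε := by
    rw [div_le_iff₀ hN']
    rwa [div_le_iff₀' hε] at hN1
  refine ⟨ANN.rampSum hd hN (16 ^ d / N) (1 / (16 ^ d * N)), rfl,
    ANN.paramNorm_rampSum_le hd hN ?_ (by positivity) ?_, ?_⟩
  · rwa [abs_of_nonneg (by positivity), div_le_one hN']
  · calc (N : ℝ) * (1 / (16 ^ d * N)) = 1 / 16 ^ d := by field_simp
      _ ≤ 1 := by
        rw [div_le_one (by positivity)]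
        exact h16
  · refine gaussianL2Error_le_of_abs_sub_le hε.le fun x => ?_
    have h := abs_riemannSum_sub_steepRampSum_le hN hdN x (fun i => 16 ^ d * x i) fun _ => rfl
    rw [ANN.realization_rampSum]
    convert h using 3
    refine Finset.sum_congr rfl fun i _ => Finset.sum_congr rfl fun k _ => ?_
    -- Positive homogeneity of the rectifier moves the steepness into the outer weight.
    have : (16 : ℝ) ^ d * x i - k / N = 16 ^ d * (x i - k * (1 / (16 ^ d * N))) := by
      field_simp
    rw [this, ← mul_zero ((16 : ℝ) ^ d), ← mul_max_of_nonneg _ _ (by positivity)]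
    simp only [mul_zero]
    ring

/-! ### The lower bound -/

/-- Networks close to the target function are large on the box `[1, 2] ^ d`. -/
theorem two_pow_le_of_gaussianL2Error {d : ℕ} (hd : 1 ≤ d) {ε M : ℝ} (hε : ε ≤ 1 / 2)
    (hM : 1 ≤ M) (Φ : ANN d 1) (hΦ : Φ.paramNorm ≤ M)
    (herr : gaussianL2Error d (fun x => Φ.realization x 0) (steepRampSum d) ≤ ENNReal.ofReal ε) :
    (2 : ℝ) ^ d ≤ (M * Φ.numParams) ^ (Φ.numHidden + 1) := by
  have hlt : gaussianL2Error d (fun x => Φ.realization x 0) (steepRampSum d) < 1 := by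
    refine herr.trans_lt ?_
    rw [← ENNReal.ofReal_one]
    exact (ENNReal.ofReal_lt_ofReal_iff one_pos).2 (by linarith)
  obtain ⟨x, hx, hclose⟩ := exists_abs_sub_lt_of_gaussianL2Error_lt_one hlt
  have h1 := ANN.abs_realization_le Φ hM hΦ le_rfl one_le_two x
    (fun j => by rw [abs_of_nonneg (by linarith [(hx j).1])]; exact (hx j).2) 0
  have h2 := le_steepRampSum hd fun i => (hx i).1
  have h3 := (abs_lt.1 hclose).1
  have h4 := le_abs_self (Φ.realization x 0)
  -- The goal is `16 ^ d - 8 ^ d - 1 / 2 ≥ 2 * 2 ^ d`, whose factor `2` cancels the radius of the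
  -- box.
  have e8 : (8 : ℝ) ^ d = 2 ^ d * 4 ^ d := by rw [← mul_pow]; norm_num
  have e16 : (16 : ℝ) ^ d = 2 ^ d * (2 ^ d * 4 ^ d) := by rw [← mul_pow, ← mul_pow]; norm_num
  have g2 : (2 : ℝ) ≤ 2 ^ d := le_self_pow₀ (by norm_num) (by omega)
  have g4 : (4 : ℝ) ≤ 4 ^ d := le_self_pow₀ (by norm_num) (by omega)
  rw [e16] at h2
  rw [e8] at h3
  have g5 : (2 : ℝ) ^ d * 4 ≤ 2 ^ d * 4 ^ d := by gcongr
  have g6 : 2 * ((2 : ℝ) ^ d * 4 ^ d) ≤ 2 ^ d * (2 ^ d * 4 ^ d) := by gcongr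
  linarith

/-- The growth condition forces exponentially many parameters below linear depth. -/
theorem rpow_le_of_two_pow_le {d H P : ℕ} {c δ : ℝ} (hd : 1 ≤ d) (hδ : 0 < δ) (hδ1 : δ ≤ 1)
    (hc : 16 ≤ c) (hP : d + 1 ≤ P) (hH : (H : ℝ) ≤ c * (d : ℝ) ^ (1 - δ))
    (h : (2 : ℝ) ^ d ≤ (c * (d : ℝ) ^ c * P) ^ (H + 1)) :
    (1 + c ^ (-3 : ℤ)) ^ ((d : ℝ) ^ δ) ≤ (P : ℝ) := by
  have hc0 : 0 < c := by linarith
  have hd' : (1 : ℝ) ≤ d := by exact_mod_cast hd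
  have hd0 : (0 : ℝ) < d := by linarith
  have hP' : (d : ℝ) + 1 ≤ P := by exact_mod_cast hP
  have hP0 : (0 : ℝ) < P := by linarith
  set a := (d : ℝ) ^ δ with ha
  have ha1 : 1 ≤ a := Real.one_le_rpow hd' hδ.le
  have hz : c ^ (-3 : ℤ) = (c ^ 3)⁻¹ := by
    rw [zpow_neg]
    norm_cast
  suffices hlog : a / c ^ 3 ≤ Real.log P by
    calc (1 + c ^ (-3 : ℤ)) ^ a ≤ (Real.exp (c ^ 3)⁻¹) ^ a := by
          rw [hz]
          refine Real.rpow_le_rpow (by positivity) ?_ (by linarith)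
          rw [add_comm]
          exact Real.add_one_le_exp _
      _ = Real.exp (a / c ^ 3) := by
          rw [← Real.exp_mul]
          congr 1
          ring
      _ ≤ Real.exp (Real.log P) := Real.exp_le_exp.2 hlog
      _ = P := Real.exp_log hP0
  have hlogP : Real.log (d + 1) ≤ Real.log P := Real.log_le_log (by linarith) hP'
  -- For small `a` the trivial bound `P ≥ d + 1` suffices; otherwise `a` dominates the logarithmic
  -- terms.
  rcases le_total a (c ^ 3 * Real.log (d + 1)) with hcase | hcase
  · refine le_trans ?_ hlogP
    rwa [div_le_iff₀' (by positivity)]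
  · have hlog2 : 1 / 2 ≤ Real.log 2 := by linarith [Real.log_two_gt_d9]
    have hl2 : 1 / 2 ≤ Real.log (d + 1) :=
      hlog2.trans (Real.log_le_log (by norm_num) (by linarith))
    have hld : Real.log d ≤ Real.log (d + 1) := Real.log_le_log hd0 (by linarith)
    have hld0 : 0 ≤ Real.log d := Real.log_nonneg hd'
    have hlc : Real.log c ≤ c := (Real.log_le_sub_one_of_pos hc0).trans (by linarith)
    have hlc0 : 0 ≤ Real.log c := Real.log_nonneg (by linarith)
    have hlP0 : 0 ≤ Real.log P := Real.log_nonneg (by linarith)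
    set b := (d : ℝ) ^ (1 - δ) with hb
    have hb1 : 1 ≤ b := Real.one_le_rpow hd' (by linarith)
    have hab : a * b = d := by
      rw [ha, hb, ← Real.rpow_add hd0]
      simp
    have hmain : (d : ℝ) * Real.log 2
        ≤ (H + 1) * (Real.log c + c * Real.log d + Real.log P) := by
      have := Real.log_le_log (by positivity) h
      rw [Real.log_pow, Real.log_pow, Real.log_mul (by positivity) hP0.ne',
        Real.log_mul hc0.ne' (by positivity), Real.log_rpow hd0] at this
      exact_mod_cast this
    have h1 : (H : ℝ) + 1 ≤ 2 * c * b := by nlinarith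
    have h2 : a * Real.log 2 ≤ 2 * c * (Real.log c + c * Real.log d + Real.log P) := by
      refine le_of_mul_le_mul_left ?_ (by linarith : 0 < b)
      calc b * (a * Real.log 2) = d * Real.log 2 := by rw [← hab]; ring
        _ ≤ _ := hmain
        _ ≤ 2 * c * b * (Real.log c + c * Real.log d + Real.log P) := by gcongr
        _ = _ := by ring
    -- The terms other than `log P` are absorbed because `a` exceeds `c ^ 3 * log (d + 1)`.
    have h3 : Real.log c ≤ 2 * a / c ^ 2 := by
      refine hlc.trans ?_
      rw [le_div_iff₀ (by positivity)]
      nlinarith [pow_pos hc0 3]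
    have h4 : c * Real.log d ≤ a / c ^ 2 := by
      rw [le_div_iff₀ (by positivity)]
      nlinarith [pow_pos hc0 3]
    have h5 : a / (4 * c) ≤ Real.log c + c * Real.log d + Real.log P := by
      rw [div_le_iff₀ (by positivity)]
      nlinarith
    have h6 : a / c ^ 3 ≤ a / c ^ 2 :=
      div_le_div_of_nonneg_left (by linarith) (by positivity)
        (pow_le_pow_right₀ (by linarith) (by norm_num))
    -- Equivalent to `16 ≤ c`. Of the four copies of `a / c ^ 2`, three absorb `log c` and `c * log
    -- d`, and the last bounds `log P` from below.
    have h7 : 4 * (a / c ^ 2) ≤ a / (4 * c) := by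
      rw [← mul_div_assoc, div_le_div_iff₀ (by positivity) (by positivity)]
      nlinarith [mul_pos (lt_of_lt_of_le one_pos ha1) hc0]
    have h8 : 2 * a / c ^ 2 = 2 * (a / c ^ 2) := mul_div_assoc _ _ _
    linarith

theorem corollary6p2 :
    ∃ f : (d : ℕ) → (Fin d → ℝ) → ℝ,
      (∀ d : ℕ, 1 ≤ d → ContDiff ℝ 1 (f d)) ∧
      ∀ δ ε : ℝ, 0 < δ → δ ≤ 1 → 0 < ε → ε ≤ 1 / 2 →
        ∃ C : ℝ, 0 < C ∧
          (∀ c : ℝ, C ≤ c → ∀ d : ℕ, 1 ≤ d →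
            ∃ p : ℕ,
              IsLeast {p : ℕ | ∃ Φ : ANN d 1, p = Φ.numParams ∧
                (d : ℝ) ≤ Φ.numHidden ∧ (Φ.numHidden : ℝ) ≤ c * d ∧
                Φ.paramNorm ≤ c * (d : ℝ) ^ c ∧
                gaussianL2Error d (fun x => Φ.realization x 0) (f d) ≤ ENNReal.ofReal ε} p ∧
              (p : ℝ) ≤ c * (d : ℝ) ^ 3) ∧
          (∀ c : ℝ, C ≤ c → ∀ d : ℕ, 1 ≤ d →
            ∃ p : ℕ,
              IsLeast {p : ℕ | ∃ Φ : ANN d 1, p = Φ.numParams ∧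
                (Φ.numHidden : ℝ) ≤ c * (d : ℝ) ^ (1 - δ) ∧
                Φ.paramNorm ≤ c * (d : ℝ) ^ c ∧
                gaussianL2Error d (fun x => Φ.realization x 0) (f d) ≤ ENNReal.ofReal ε} p ∧
              (1 + c ^ (-3 : ℤ)) ^ ((d : ℝ) ^ δ) ≤ (p : ℝ)) := by
  refine ⟨steepRampSum, fun d _ => contDiff_steepRampSum d, fun δ ε hδ hδ1 hε hε1 => ?_⟩
  -- The constant `16 / ε` comes from the deep network's parameter count; being at least `32`, it
  -- also covers the weight bound `16` and the condition `16 ≤ c`.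
  have hC : 32 ≤ 16 / ε := by
    rw [le_div_iff₀ hε]
    linarith
  have hrpow : ∀ c : ℝ, 16 / ε ≤ c → ∀ d : ℕ, 1 ≤ d → c ≤ c * (d : ℝ) ^ c := fun c hc d hd =>
    le_mul_of_one_le_right (by linarith)
      (Real.one_le_rpow (by exact_mod_cast hd) (by linarith))
  refine ⟨16 / ε, by linarith, fun c hc d hd => ?_, fun c hc d hd => ?_⟩
  · have hd' : (1 : ℝ) ≤ d := by exact_mod_cast hd
    obtain ⟨Φ, hH, hnorm, hP, herr⟩ := exists_deep_ann hd hε hε1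
    have hmem : Φ.numParams ∈ {p : ℕ | ∃ Φ : ANN d 1, p = Φ.numParams ∧
        (d : ℝ) ≤ Φ.numHidden ∧ (Φ.numHidden : ℝ) ≤ c * d ∧
        Φ.paramNorm ≤ c * (d : ℝ) ^ c ∧
        gaussianL2Error d (fun x => Φ.realization x 0) (steepRampSum d) ≤ ENNReal.ofReal ε} := by
      refine ⟨Φ, rfl, ?_, ?_, ?_, herr⟩
      · rw [hH]
        push_cast
        linarith
      · rw [hH]
        push_cast
        nlinarith
      · linarith [hrpow c hc d hd]
    refine ⟨_, ⟨Nat.sInf_mem ⟨_, hmem⟩, fun q hq => Nat.sInf_le hq⟩, ?_⟩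
    calc ((sInf _ : ℕ) : ℝ) ≤ Φ.numParams := by exact_mod_cast Nat.sInf_le hmem
      _ ≤ 16 / ε * (d : ℝ) ^ 3 := hP
      _ ≤ c * (d : ℝ) ^ 3 := by gcongr
  · have hd' : (1 : ℝ) ≤ d := by exact_mod_cast hd
    obtain ⟨Φ, hH, hnorm, herr⟩ := exists_shallow_ann hd hε
    have hne : {p : ℕ | ∃ Φ : ANN d 1, p = Φ.numParams ∧
        (Φ.numHidden : ℝ) ≤ c * (d : ℝ) ^ (1 - δ) ∧
        Φ.paramNorm ≤ c * (d : ℝ) ^ c ∧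
        gaussianL2Error d (fun x => Φ.realization x 0) (steepRampSum d)
          ≤ ENNReal.ofReal ε}.Nonempty := by
      refine ⟨_, Φ, rfl, ?_, ?_, herr⟩
      · rw [hH]
        push_cast
        nlinarith [Real.one_le_rpow hd' (sub_nonneg.2 hδ1)]
      · linarith [hrpow c hc d hd]
    have hmin := Nat.sInf_mem hne
    refine ⟨_, ⟨hmin, fun q hq => Nat.sInf_le hq⟩, ?_⟩
    obtain ⟨Ψ, hPΨ, hHΨ, hnormΨ, herrΨ⟩ := hmin
    rw [hPΨ]
    exact rpow_le_of_two_pow_le hd hδ hδ1 (by linarith) Ψ.input_lt_numParams hHΨ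
      (two_pow_le_of_gaussianL2Error hd hε1 (by linarith [hrpow c hc d hd]) Ψ hnormΨ herrΨ)
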